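/- For a poset $D$ write $x\ll y$ if for every directed (non-empty) $S\subseteq D$ possessing a least upper bound with $y\sqsubseteq\bigsqcup S$ there is $u\in S$ with $x\sqsubseteq u$; $x$ is compact if $x\ll x$. A set $B\subseteq D$ is a basis if for each $x\in D$ the set $\{u\in B: u\ll x\}$ contains a directed subset with least upper bound $x$. A domain is a directed-complete poset that has a basis; it is algebraic if its compact elements form a basis, and pointed if it has a least element. Let $\mathbf{DOM}$ be the category of domains and Scott continuous functions (functions preserving all existing least upper bounds of directed subsets), and let $\mathbf{DOM}_\bot$, $\mathbf{aDOM}$, $\mathbf{aDOM}_\bot$ be its full subcategories of pointed, of algebraic, and of pointed algebraic domains. An information frame $\mathbb{A}=(A,(\mathrm{Con}_i)_{i\in A},(\vdash_i)_{i\in A})$ consists of a set $A$, sets $\mathrm{Con}_i$ of finite subsets of $A$, and relations $\vdash_i\subseteq\mathrm{Con}_i\times A$. Write $iRj$ for $\{i\}\in\mathrm{Con}_j$, and $X\vdash_i Y$ if $X\vdash_i b$ for all $b\in Y$. For all $i,j,a\in A$ and all finite $X,Y\subseteq A$ it is required that: 1. $\{i\}\in\mathrm{Con}_i$; 2. $Y\subseteq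 X$ and $X\in\mathrm{Con}_i$ imply $Y\in\mathrm{Con}_i$; 3. $X\in\mathrm{Con}_i$ and $X\vdash_i Y$ imply $Y\in\mathrm{Con}_i$; 4. $X,Y\in\mathrm{Con}_i$, $X\subseteq Y$ and $X\vdash_i a$ imply $Y\vdash_i a$; 5. $X\in\mathrm{Con}_i$, $X\vdash_i Y$ and $Y\vdash_i a$ imply $X\vdash_i a$; 6. $iRj$ implies $\mathrm{Con}_i\subseteq\mathrm{Con}_j$; 7. $iRj$, $X\in\mathrm{Con}_i$ and $X\vdash_i a$ imply $X\vdash_j a$; 8. $X\in\mathrm{Con}_i$ and $X\vdash_i Y$ imply that there are $e\in A$ and $Z\in\mathrm{Con}_e$ with $X\vdash_i\{e\}\cup Z$ and $Z\vdash_e Y$. $\mathbb{A}$ is algebraic if $X\vdash_i\{i\}\cup X$ for all $i\in A$ and $X\in\mathrm{Con}_i$, and strong if $\{i\}\vdash_i X$ for all $i\in A$ and $X\in\mathrm{Con}_i$ with $X\neq\{i\}$. A truth element is a $\mathbf{t}\in A$ with $\emptyset\vdash_i\mathbf{t}$ for all $i\in A$. An approximable mapping $H:\mathbb{A}\to\mathbb{A}'$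 is a family of relations $H_i\subseteq\mathrm{Con}_i\times A'$ $(i\in A)$ such that, writing $XH_iY$ if $XH_ic$ for all $c\in Y$, for all $i,j\in A$, $X,X'\in\mathrm{Con}_i$, $Y\in\bigcup_{p\in A'}\mathrm{Con}'_p$, $b,k\in A'$ and finite $F\subseteq A'$: 1. $XH_i(\{k\}\cup Y)$ and $Y\vdash'_k b$ imply $XH_ib$; 2. $X\subseteq X'$ and $XH_ib$ imply $X'H_ib$; 3. $X\vdash_iX'$ and $X'H_ib$ imply $XH_ib$; 4. $iRj$ and $XH_ib$ imply $XH_jb$; 5. $XH_iF$ implies that there are $c\in A$, $e\in A'$, $U\in\mathrm{Con}_c$, $V\in\mathrm{Con}'_e$ with $X\vdash_i\{c\}\cup U$, $UH_c(\{e\}\cup V)$ and $V\vdash'_eF$. If $\mathbb{A}$ and $\mathbb{A}'$ have truth elements, $H$ respects truth elements if $\emptyset H_{\mathbf{t}}\mathbf{t}'$ for all truth elements $\mathbf{t}$ of $\mathbb{A}$ and $\mathbf{t}'$ of $\mathbb{A}'$. The identity on $\mathbb{A}$ is $(\vdash_i)_{i\in A}$; the composite of $G:\mathbb{A}^{(1)}\to\mathbb{A}^{(2)}$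 and $H:\mathbb{A}^{(2)}\to\mathbb{A}^{(3)}$ relates $X\in\mathrm{Con}^{(1)}_i$ at $i$ to $a$ iff there are $e\in A^{(2)}$ and $V\in\mathrm{Con}^{(2)}_e$ with $XG_i(\{e\}\cup V)$ and $VH_ea$. This gives the category $\mathbf{INF}$ of information frames and approximable mappings. Let $\mathbf{aINF}$, $\mathbf{sINF}$, $\mathbf{asINF}$ be its full subcategories of algebraic, of strong, and of algebraic strong information frames; let $\mathbf{INF}_{\mathbf{t}}$ be the subcategory of information frames having a truth element and approximable mappings respecting truth elements, and let $\mathbf{aINF}_{\mathbf{t}}$, $\mathbf{sINF}_{\mathbf{t}}$, $\mathbf{asINF}_{\mathbf{t}}$ be the full subcategories of $\mathbf{INF}_{\mathbf{t}}$ of algebraic, of strong, and of algebraic strong information frames. **Corollary.** The following categories are equivalent: - $\mathbf{DOM}$ and $\mathbf{sINF}$; - $\mathbf{DOM}_\bot$, $\mathbf{INF}_{\mathbf{t}}$ and $\mathbf{sINF}_{\mathbf{t}}$; - $\mathbf{aDOM}$, $\mathbf{aINF}$ and $\mathbf{asINF}$; - $\mathbf{aDOM}_\bot$, $\mathbf{aINF}_{\mathbf{t}}$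 and $\mathbf{asINF}_{\mathbf{t}}$. -/

import Mathlib

open CategoryTheory

universe u

/-! ## Domains -/

section Order

variable {D : Type u} [PartialOrder D]

/-- `x` approximates `y` (the way-below relation `x ≪ y`): whenever a directed set `S` has a
least upper bound above `y`, some element of `S` is above `x`. -/
def WayBelow (x y : D) : Prop :=
  ∀ (S : Set D), S.Nonempty → DirectedOn (· ≤ ·) S → ∀ s : D, IsLUB S s → y ≤ s →
    ∃ v ∈ S, x ≤ v

/-- `B` is a basis: for each `x`, the set of all `b ∈ B` with `b ≪ x` contains a directed subset
with least upper bound `x`. -/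
def IsDomainBasis (B : Set D) : Prop :=
  ∀ x : D, ∃ S : Set D, S ⊆ {b | b ∈ B ∧ WayBelow b x} ∧ S.Nonempty ∧
    DirectedOn (· ≤ ·) S ∧ IsLUB S x

variable (D)

/-- `D` is a directed-complete partial order. -/
def IsDcpo : Prop :=
  ∀ S : Set D, S.Nonempty → DirectedOn (· ≤ ·) S → ∃ s : D, IsLUB S s

/-- `D` is a domain (a continuous dcpo): a dcpo with a basis. -/
def IsDomainOrder : Prop :=
  IsDcpo D ∧ ∃ B : Set D, IsDomainBasis B

/-- `D` is an algebraic domain: a dcpo whose compact elements form a basis.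
`IsCompactElement x` says that `x` approximates itself. -/
def IsAlgebraicOrder : Prop :=
  IsDcpo D ∧ IsDomainBasis {x : D | IsCompactElement x}

/-- `D` has a least element. -/
def IsPointedOrder : Prop :=
  ∃ b : D, ∀ x : D, b ≤ x

end Order

/-- The objects of the category `DOM` of domains and Scott continuous functions. -/
structure DOM : Type (u + 1) where
  carrier : Type u
  [order : PartialOrder carrier]
  isDomain : IsDomainOrder carrier

namespace DOM

attribute [instance] DOM.order

/-- A morphism of domains is a Scott continuous function. -/
@[ext]
structure Hom (D E : DOM.{u}) : Type u where
  toFun : D.carrier → E.carrier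
  scott : ScottContinuous toFun

instance : Category DOM.{u} where
  Hom := Hom
  id _ := ⟨fun x => x, ScottContinuous.id⟩
  comp f g := ⟨fun x => g.toFun (f.toFun x), f.scott.comp g.scott⟩

end DOM

/-- The full subcategory of algebraic domains. -/
abbrev ADOM : Type (u + 1) :=
  ObjectProperty.FullSubcategory (fun D : DOM.{u} => IsAlgebraicOrder D.carrier)

/-- The full subcategory of pointed domains. -/
abbrev PDOM : Type (u + 1) :=
  ObjectProperty.FullSubcategory (fun D : DOM.{u} => IsPointedOrder D.carrier)

/-- The full subcategory of pointed algebraic domains. -/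
abbrev APDOM : Type (u + 1) :=
  ObjectProperty.FullSubcategory
    (fun D : DOM.{u} => IsAlgebraicOrder D.carrier ∧ IsPointedOrder D.carrier)

/-! ## Information frames -/

/-- Information frames, the objects of the category `INF`. `Con i` is the family of finite
sets consistent with respect to the node `i`, and `Ent i X a` is the entailment `X ⊢_i a`.
The accessibility relation `i R j` is `{i} ∈ Con j`, and `X ⊢_i Y` for a set `Y` means `X ⊢_i b`
for all `b ∈ Y`. -/
structure INF : Type (u + 1) where
  Token : Type u
  Con : Token → Set (Finset Token)
  Ent : Token → Finset Token → Token → Prop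
  /-- Each `⊢_i` is a relation between `Con i` and tokens. -/
  ent_con : ∀ {i X a}, Ent i X a → X ∈ Con i
  self_con : ∀ i, {i} ∈ Con i
  con_mono : ∀ {i X Y}, Y ⊆ X → X ∈ Con i → Y ∈ Con i
  sound : ∀ {i X} {Y : Finset Token}, X ∈ Con i → (∀ b ∈ Y, Ent i X b) → Y ∈ Con i
  weaken : ∀ {i X Y a}, X ∈ Con i → Y ∈ Con i → X ⊆ Y → Ent i X a → Ent i Y a
  cut : ∀ {i X} {Y : Finset Token} {a}, X ∈ Con i → (∀ b ∈ Y, Ent i X b) → Ent i Y a →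
    Ent i X a
  con_transfer : ∀ {i j}, {i} ∈ Con j → Con i ⊆ Con j
  ent_transfer : ∀ {i j X a}, {i} ∈ Con j → X ∈ Con i → Ent i X a → Ent j X a
  interpolation : ∀ {i X} {Y : Finset Token}, X ∈ Con i → (∀ b ∈ Y, Ent i X b) →
    ∃ (e : Token) (Z : Finset Token), Z ∈ Con e ∧
      (∀ b ∈ insert e (Z : Set Token), Ent i X b) ∧ (∀ b ∈ Y, Ent e Z b)

namespace INF

/-- The accessibility relation of the Kripke frame underlying `A`. -/
def R (A : INF.{u}) (i j : A.Token) : Prop := {i} ∈ A.Con j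

/-- Condition (AL). -/
def IsAlgebraic (A : INF.{u}) : Prop :=
  ∀ (i : A.Token), ∀ X ∈ A.Con i, ∀ b ∈ insert i (X : Set A.Token), A.Ent i X b

/-- Condition (S). -/
def IsStrong (A : INF.{u}) : Prop :=
  ∀ (i : A.Token), ∀ X ∈ A.Con i, X ≠ {i} → ∀ b ∈ X, A.Ent i {i} b

/-- `t` is a truth element of `A`. -/
def IsTruthElement (A : INF.{u}) (t : A.Token) : Prop :=
  ∀ i : A.Token, A.Ent i ∅ t

/-- `A` has a truth element. -/
def HasTruthElement (A : INF.{u}) : Prop :=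
  ∃ t : A.Token, A.IsTruthElement t

theorem empty_con (A : INF.{u}) (i : A.Token) : ∅ ∈ A.Con i :=
  A.con_mono (Finset.empty_subset _) (A.self_con i)

theorem strong_cut (A : INF.{u}) {i j a : A.Token} {X Y : Finset A.Token}
    (h : ∀ b ∈ insert j (Y : Set A.Token), A.Ent i X b) (h' : A.Ent j Y a) : A.Ent i X a := by
  have hj : A.Ent i X j := h j (Set.mem_insert _ _)
  have hX := A.ent_con hj
  have hR : {j} ∈ A.Con i := A.sound hX (by simpa using hj)
  exact A.cut hX (fun b hb => h b (Set.mem_insert_of_mem _ hb))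
    (A.ent_transfer hR (A.ent_con h') h')

/-- Approximable mappings between information frames, the morphisms of the category `INF`:
`rel i X b` is the relation `X H_i b`. -/
@[ext]
structure Hom (A B : INF.{u}) : Type u where
  rel : A.Token → Finset A.Token → B.Token → Prop
  /-- Each `H_i` is a relation between `Con i` and tokens of `B`. -/
  rel_con : ∀ {i X b}, rel i X b → X ∈ A.Con i
  rel_ent : ∀ {i X k} {Y : Finset B.Token} {b}, X ∈ A.Con i → (∃ p, Y ∈ B.Con p) →
    (∀ c ∈ insert k (Y : Set B.Token), rel i X c) → B.Ent k Y b → rel i X b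
  mono : ∀ {i X X' b}, X ∈ A.Con i → X' ∈ A.Con i → X ⊆ X' → rel i X b → rel i X' b
  ent_rel : ∀ {i X} {X' : Finset A.Token} {b}, X ∈ A.Con i → X' ∈ A.Con i →
    (∀ a ∈ X', A.Ent i X a) → rel i X' b → rel i X b
  transfer : ∀ {i j X b}, X ∈ A.Con i → A.R i j → rel i X b → rel j X b
  interpolation : ∀ {i X} {F : Finset B.Token}, X ∈ A.Con i → (∀ b ∈ F, rel i X b) →
    ∃ (c : A.Token) (e : B.Token) (U : Finset A.Token) (V : Finset B.Token),
      U ∈ A.Con c ∧ V ∈ B.Con e ∧ (∀ a ∈ insert c (U : Set A.Token), A.Ent i X a) ∧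
      (∀ b ∈ insert e (V : Set B.Token), rel c U b) ∧ (∀ b ∈ F, B.Ent e V b)

namespace Hom

variable {A B C : INF.{u}}

theorem strong_ent_rel (H : Hom A B) {i j : A.Token} {X Y : Finset A.Token} {b : B.Token}
    (h : ∀ a ∈ insert j (Y : Set A.Token), A.Ent i X a) (h' : H.rel j Y b) : H.rel i X b := by
  have hj : A.Ent i X j := h j (Set.mem_insert _ _)
  have hX := A.ent_con hj
  have hR : A.R j i := A.sound hX (by simpa using hj)
  exact H.ent_rel hX (A.con_transfer hR (H.rel_con h'))
    (fun a ha => h a (Set.mem_insert_of_mem _ ha)) (H.transfer (H.rel_con h') hR h')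

theorem interp_dom (H : Hom A B) {i : A.Token} {X : Finset A.Token} {F : Finset B.Token}
    (hX : X ∈ A.Con i) (h : ∀ b ∈ F, H.rel i X b) :
    ∃ (c : A.Token) (U : Finset A.Token), U ∈ A.Con c ∧
      (∀ a ∈ insert c (U : Set A.Token), A.Ent i X a) ∧ (∀ b ∈ F, H.rel c U b) := by
  obtain ⟨c, e, U, V, hU, hV, h1, h2, h3⟩ := H.interpolation hX h
  exact ⟨c, U, hU, h1, fun b hb => H.rel_ent hU ⟨e, hV⟩ h2 (h3 b hb)⟩

theorem interp_cod (H : Hom A B) {i : A.Token} {X : Finset A.Token} {F : Finset B.Token}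
    (hX : X ∈ A.Con i) (h : ∀ b ∈ F, H.rel i X b) :
    ∃ (e : B.Token) (V : Finset B.Token), V ∈ B.Con e ∧
      (∀ b ∈ insert e (V : Set B.Token), H.rel i X b) ∧ (∀ b ∈ F, B.Ent e V b) := by
  obtain ⟨c, e, U, V, hU, hV, h1, h2, h3⟩ := H.interpolation hX h
  exact ⟨e, V, hV, fun b hb => H.strong_ent_rel h1 (h2 b hb), h3⟩

/-- The relation `X (G ∘ H)_i a` of the composite of two approximable mappings (first `G`,
then `H`). -/
def compRel (G : Hom A B) (H : Hom B C) (i : A.Token) (X : Finset A.Token) (a : C.Token) : Prop :=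
  ∃ (e : B.Token) (V : Finset B.Token), V ∈ B.Con e ∧
    (∀ b ∈ insert e (V : Set B.Token), G.rel i X b) ∧ H.rel e V a

theorem compRel_finset (G : Hom A B) (H : Hom B C) {i : A.Token} {X : Finset A.Token}
    {F : Finset C.Token} (hX : X ∈ A.Con i) (h : ∀ a ∈ F, compRel G H i X a) :
    ∃ (e : B.Token) (V : Finset B.Token), V ∈ B.Con e ∧
      (∀ b ∈ insert e (V : Set B.Token), G.rel i X b) ∧ (∀ a ∈ F, H.rel e V a) := by
  classical
  have h' : ∀ a : F, compRel G H i X a.1 := fun a => h a.1 a.2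
  choose e V hV hG hH using h'
  obtain ⟨d, W, hW, h1, h2⟩ := G.interp_cod (F := F.attach.biUnion fun a => insert (e a) (V a)) hX
    (fun b hb => by
      simp only [Finset.mem_biUnion, Finset.mem_attach, true_and] at hb
      obtain ⟨a, ha⟩ := hb
      exact hG a b (by simpa using ha))
  refine ⟨d, W, hW, h1, fun a ha => H.strong_ent_rel (j := e ⟨a, ha⟩) (Y := V ⟨a, ha⟩) ?_
    (hH ⟨a, ha⟩)⟩
  intro b hb
  refine h2 b ?_
  simp only [Finset.mem_biUnion, Finset.mem_attach, true_and]
  exact ⟨⟨a, ha⟩, by simpa using hb⟩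

/-- The identity approximable mapping is the family of entailment relations. -/
def id (A : INF.{u}) : Hom A A where
  rel := A.Ent
  rel_con := A.ent_con
  rel_ent _ _ h h' := A.strong_cut h h'
  mono := A.weaken
  ent_rel hX _ h h' := A.cut hX h h'
  transfer hX hR h := A.ent_transfer hR hX h
  interpolation := by
    classical
    intro i X F hX h
    obtain ⟨e, V, hV, h1, h2⟩ := A.interpolation hX h
    obtain ⟨c, U, hU, h3, h4⟩ := A.interpolation (Y := insert e V) hX
      (fun b hb => h1 b (by simpa using hb))
    exact ⟨c, e, U, V, hU, hV, h3, fun b hb => h4 b (by simpa using hb), h2⟩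

/-- Composition of approximable mappings (first `G`, then `H`). -/
def comp (G : Hom A B) (H : Hom B C) : Hom A C where
  rel := compRel G H
  rel_con := fun ⟨e, _, _, h, _⟩ => G.rel_con (h e (Set.mem_insert _ _))
  rel_ent := by
    classical
    intro i X k Y b hX hY h hb
    obtain ⟨e, V, hV, h1, h2⟩ := compRel_finset G H (F := insert k Y) hX
      (fun c hc => h c (by simpa using hc))
    exact ⟨e, V, hV, h1, H.rel_ent hV hY (fun c hc => h2 c (by simpa using hc)) hb⟩
  mono := by
    rintro i X X' b hX hX' hs ⟨e, V, hV, h1, h2⟩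
    exact ⟨e, V, hV, fun c hc => G.mono hX hX' hs (h1 c hc), h2⟩
  ent_rel := by
    rintro i X X' b hX hX' hs ⟨e, V, hV, h1, h2⟩
    exact ⟨e, V, hV, fun c hc => G.ent_rel hX hX' hs (h1 c hc), h2⟩
  transfer := by
    rintro i j X b hX hR ⟨e, V, hV, h1, h2⟩
    exact ⟨e, V, hV, fun c hc => G.transfer hX hR (h1 c hc), h2⟩
  interpolation := by
    classical
    intro i X F hX h
    obtain ⟨e, V, hV, h1, h2⟩ := compRel_finset G H hX h
    obtain ⟨c, U, hU, h3, h4⟩ := G.interp_dom (F := insert e V) hX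
      (fun b hb => h1 b (by simpa using hb))
    obtain ⟨f, W, hW, h5, h6⟩ := H.interp_cod hV h2
    exact ⟨c, f, U, W, hU, hW, h3,
      fun b hb => ⟨e, V, hV, fun a ha => h4 a (by simpa using ha), h5 b hb⟩, h6⟩

theorem id_comp (H : Hom A B) : comp (id A) H = H := by
  ext i X b
  constructor
  · rintro ⟨e, V, -, h1, h2⟩
    exact H.strong_ent_rel h1 h2
  · intro h
    obtain ⟨c, U, hU, h1, h2⟩ := H.interp_dom (F := {b}) (H.rel_con h) (by simpa using h)
    exact ⟨c, U, hU, h1, h2 b (by simp)⟩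

theorem comp_id (H : Hom A B) : comp H (id B) = H := by
  ext i X b
  constructor
  · rintro ⟨e, V, hV, h1, h2⟩
    exact H.rel_ent (H.rel_con (h1 e (Set.mem_insert _ _))) ⟨e, hV⟩ h1 h2
  · intro h
    obtain ⟨e, V, hV, h1, h2⟩ := H.interp_cod (F := {b}) (H.rel_con h) (by simpa using h)
    exact ⟨e, V, hV, h1, h2 b (by simp)⟩

theorem comp_assoc {E : INF.{u}} (G : Hom A B) (H : Hom B C) (K : Hom C E) :
    comp (comp G H) K = comp G (comp H K) := by
  classical
  ext i X b
  constructor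
  · rintro ⟨e, V, hV, h1, h2⟩
    obtain ⟨d, W, hW, h3, h4⟩ := compRel_finset G H (F := insert e V)
      ((comp G H).rel_con (h1 e (Set.mem_insert _ _))) (fun c hc => h1 c (by simpa using hc))
    exact ⟨d, W, hW, h3, e, V, hV, fun c hc => h4 c (by simpa using hc), h2⟩
  · rintro ⟨d, W, hW, h3, e, V, hV, h4, h2⟩
    exact ⟨e, V, hV, fun c hc => ⟨d, W, hW, h3, h4 c hc⟩, h2⟩

/-- `H` respects truth elements: `∅ H_t t'` for truth elements `t` of `A` and `t'` of `B`. -/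
def RespectsTruth (H : Hom A B) : Prop :=
  ∀ (t : A.Token) (t' : B.Token), A.IsTruthElement t → B.IsTruthElement t' → H.rel t ∅ t'

end Hom

instance : Category INF.{u} where
  Hom := Hom
  id := Hom.id
  comp := Hom.comp
  id_comp := Hom.id_comp
  comp_id := Hom.comp_id
  assoc := Hom.comp_assoc

end INF

/-- The full subcategory of algebraic information frames. -/
abbrev AINF : Type (u + 1) :=
  ObjectProperty.FullSubcategory (fun A : INF.{u} => A.IsAlgebraic)

/-- The full subcategory of strong information frames. -/
abbrev SINF : Type (u + 1) :=
  ObjectProperty.FullSubcategory (fun A : INF.{u} => A.IsStrong)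

/-- The full subcategory of algebraic strong information frames. -/
abbrev ASINF : Type (u + 1) :=
  ObjectProperty.FullSubcategory (fun A : INF.{u} => A.IsAlgebraic ∧ A.IsStrong)

/-- The objects of the category `INF_t`: information frames with a truth element. -/
structure TINF : Type (u + 1) where
  frame : INF.{u}
  hasTruth : frame.HasTruthElement

namespace TINF

/-- The morphisms of `INF_t`: approximable mappings that respect truth elements. -/
@[ext]
structure Hom (A B : TINF.{u}) : Type u where
  toHom : INF.Hom A.frame B.frame
  respects : toHom.RespectsTruth

instance : Category TINF.{u} where
  Hom := Hom
  id A := ⟨INF.Hom.id A.frame, fun t _ _ ht' => ht' t⟩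
  comp {_ B _} G H := ⟨G.toHom.comp H.toHom, fun t t' ht ht' => by
    obtain ⟨s, hs⟩ := B.hasTruth
    exact ⟨s, ∅, B.frame.empty_con s, by simpa using G.respects t s ht hs, H.respects s t' hs ht'⟩⟩
  id_comp H := Hom.ext (INF.Hom.id_comp H.toHom)
  comp_id H := Hom.ext (INF.Hom.comp_id H.toHom)
  assoc G H K := Hom.ext (INF.Hom.comp_assoc G.toHom H.toHom K.toHom)

end TINF

/-- The full subcategory of `INF_t` of algebraic frames. -/
abbrev ATINF : Type (u + 1) :=
  ObjectProperty.FullSubcategory (fun A : TINF.{u} => A.frame.IsAlgebraic)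

/-- The full subcategory of `INF_t` of strong frames. -/
abbrev STINF : Type (u + 1) :=
  ObjectProperty.FullSubcategory (fun A : TINF.{u} => A.frame.IsStrong)

/-- The full subcategory of `INF_t` of algebraic strong frames. -/
abbrev ASTINF : Type (u + 1) :=
  ObjectProperty.FullSubcategory (fun A : TINF.{u} => A.frame.IsAlgebraic ∧ A.frame.IsStrong)

/-! A single functor carries all the equivalences: `INF.stateFunctor` sends a frame to its domain of
states, ordered by inclusion. Directed suprema of states are unions, and each state is the directed
union of the principal states of its finite parts. So a Scott continuous function is determined by
its values at principal states, and these values are exactly the data of an approximable mapping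
(`mem_map_principal`, `map_ofScott`); hence the functor is full and faithful.

Conversely, if `B` is a basis of `D`, the states of `frameOfBasis` are precisely the sets of basis
elements approximating some `d`, so `D` is recovered up to isomorphism (`orderIsoState`). This frame
is always strong, is algebraic when `B` consists of compact elements, and has a truth element when
`D` is pointed; in the other direction, algebraic frames have algebraic domains of states, and
frames with a truth element have pointed ones. Respect for truth elements is automatic, so
`TINF.forget` is fully faithful too, and each equivalence arises by restricting the state functor to
its essential image. -/

/-! ## The way-below relation on a domain -/

section WayBelowLemmas

variable {D : Type u} [PartialOrder D]

theorem isCompactElement_iff_wayBelow {x : D} : IsCompactElement x ↔ WayBelow x x :=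
  ⟨fun h S hS hd s hs hx => h S s hS hd hs hx, fun h S s hS hd hs hx => h S hS hd s hs hx⟩

theorem WayBelow.le {x y : D} (h : WayBelow x y) : x ≤ y := by
  obtain ⟨v, hv, hxv⟩ := h {y} (Set.singleton_nonempty y) (directedOn_singleton y) y
    isLUB_singleton le_rfl
  exact hxv.trans_eq hv

theorem WayBelow.trans_le {x y z : D} (h : WayBelow x y) (h' : y ≤ z) : WayBelow x z :=
  fun S hS hd s hs hz => h S hS hd s hs (h'.trans hz)

theorem WayBelow.le_trans {x y z : D} (h' : x ≤ y) (h : WayBelow y z) : WayBelow x z :=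
  fun S hS hd s hs hz =>
    let ⟨v, hv, hyv⟩ := h S hS hd s hs hz
    ⟨v, hv, h'.trans hyv⟩

theorem WayBelow.trans {x y z : D} (h : WayBelow x y) (h' : WayBelow y z) : WayBelow x z :=
  h.trans_le h'.le

/-- In a nonempty directed set every finite family of elements that lie below members of the set
has a common upper bound in the set. -/
theorem DirectedOn.exists_finset_bound {S : Set D} (hS : S.Nonempty)
    (hd : DirectedOn (· ≤ ·) S) {ι : Type*} (f : ι → D) (F : Finset ι)
    (h : ∀ i ∈ F, ∃ v ∈ S, f i ≤ v) : ∃ v ∈ S, ∀ i ∈ F, f i ≤ v := by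
  classical
  induction F using Finset.induction_on with
  | empty =>
    obtain ⟨v, hv⟩ := hS
    exact ⟨v, hv, by simp⟩
  | insert a F _ ih =>
    obtain ⟨v, hv, hF⟩ := ih fun i hi => h i (Finset.mem_insert_of_mem hi)
    obtain ⟨w, hw, ha⟩ := h a (Finset.mem_insert_self _ _)
    obtain ⟨z, hz, hvz, hwz⟩ := hd v hv w hw
    refine ⟨z, hz, fun i hi => ?_⟩
    rcases Finset.mem_insert.1 hi with rfl | hi
    · exact ha.trans hwz
    · exact (hF i hi).trans hvz

/-- A basis interpolates between a finite set and an element it approximates. -/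
theorem IsDomainBasis.interpolation {B : Set D} (hB : IsDomainBasis B) {ι : Type*} (f : ι → D)
    (F : Finset ι) {y : D} (h : ∀ i ∈ F, WayBelow (f i) y) :
    ∃ b ∈ B, WayBelow b y ∧ ∀ i ∈ F, WayBelow (f i) b := by
  choose S hSB hSne hSd hSl using hB
  -- `T` consists of the approximants of approximants of `y`. It is directed with supremum `y`, so
  -- `f i ≪ y` puts `f i` below a member of `T`, which itself approximates some `b ∈ S y`.
  let T : Set D := {c | ∃ b ∈ S y, WayBelow c b}
  have hT : T.Nonempty := by
    obtain ⟨b, hb⟩ := hSne y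
    obtain ⟨c, hc⟩ := hSne b
    exact ⟨c, b, hb, (hSB b hc).2⟩
  have hTd : DirectedOn (· ≤ ·) T := by
    rintro c ⟨b, hb, hcb⟩ c' ⟨b', hb', hcb'⟩
    obtain ⟨d, hd, hbd, hbd'⟩ := hSd y b hb b' hb'
    obtain ⟨v, hv, hcv⟩ := (hcb.trans_le hbd) (S d) (hSne d) (hSd d) d (hSl d) le_rfl
    obtain ⟨v', hv', hcv'⟩ := (hcb'.trans_le hbd') (S d) (hSne d) (hSd d) d (hSl d) le_rfl
    obtain ⟨w, hw, hvw, hvw'⟩ := hSd d v hv v' hv'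
    exact ⟨w, ⟨d, hd, (hSB d hw).2⟩, hcv.trans hvw, hcv'.trans hvw'⟩
  have hTl : IsLUB T y := by
    refine ⟨?_, fun u hu => (hSl y).2 fun b hb => (hSl b).2 fun c hc => ?_⟩
    · rintro c ⟨b, hb, hcb⟩
      exact hcb.le.trans (hSB y hb).2.le
    · exact hu ⟨b, hb, (hSB b hc).2⟩
  obtain ⟨c, ⟨b, hb, hcb⟩, hc⟩ := hTd.exists_finset_bound hT f F
    fun i hi => h i hi T hT hTd y hTl le_rfl
  exact ⟨b, (hSB y hb).1, (hSB y hb).2, fun i hi => WayBelow.le_trans (hc i hi) hcb⟩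

end WayBelowLemmas

/-! ## The information frame of a domain with a basis -/

section FrameOfBasis

variable {D : Type u} [PartialOrder D] {B : Set D}

/-- The information frame of a basis `B`: besides `{i}`, the consistent sets at `i` are the finite
sets of basis elements approximating `i`, and these elements are entailed at `i`. -/
def frameOfBasis (hB : IsDomainBasis B) : INF.{u} where
  Token := B
  -- The singleton `{i}` is adjoined by hand because `i ≪ i` fails when `i` is not compact.
  Con i := {X | X = {i} ∨ ∀ b ∈ X, WayBelow b.1 i.1}
  Ent i X a := (X = {i} ∨ ∀ b ∈ X, WayBelow b.1 i.1) ∧ WayBelow a.1 i.1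
  ent_con h := h.1
  self_con i := Or.inl rfl
  con_mono := by
    rintro i X Y hYX (rfl | hX)
    · rcases Finset.subset_singleton_iff.1 hYX with rfl | rfl
      · exact Or.inr (by simp)
      · exact Or.inl rfl
    · exact Or.inr fun b hb => hX b (hYX hb)
  sound _ hY := Or.inr fun b hb => (hY b hb).2
  weaken _ hY _ h := ⟨hY, h.2⟩
  cut hX _ h := ⟨hX, h.2⟩
  con_transfer := by
    rintro i j hij X (rfl | hX)
    · exact hij
    · rcases hij with hij | hij
      · obtain rfl := Finset.singleton_injective hij
        exact Or.inr hX
      · exact Or.inr fun b hb => (hX b hb).trans (hij i (by simp))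
  ent_transfer := by
    rintro i j X a hij hX ⟨-, ha⟩
    rcases hij with hij | hij
    · obtain rfl := Finset.singleton_injective hij
      exact ⟨hX, ha⟩
    · have hij := hij i (by simp)
      refine ⟨Or.inr ?_, ha.trans hij⟩
      rcases hX with rfl | hX
      · simpa using hij
      · exact fun b hb => (hX b hb).trans hij
  interpolation := by
    intro i X Y hX hY
    obtain ⟨e, he, hei, hYe⟩ := hB.interpolation (fun b : B => b.1) Y fun b hb => (hY b hb).2
    -- Entailment at a node does not depend on which consistent set is used, so the empty set
    -- suffices as interpolant.
    refine ⟨⟨e, he⟩, ∅, Or.inr (by simp), ?_, fun b hb => ⟨Or.inr (by simp), hYe b hb⟩⟩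
    intro b hb
    obtain rfl : b = ⟨e, he⟩ := by simpa using hb
    exact ⟨hX, hei⟩

theorem frameOfBasis_isStrong (hB : IsDomainBasis B) : (frameOfBasis hB).IsStrong := by
  intro i X hX hne b hb
  exact ⟨Or.inl rfl, hX.resolve_left hne b hb⟩

/-- Over compact elements the exceptional set `{i}` also consists of approximants of `i`. -/
theorem frameOfBasis_isAlgebraic (hB : IsDomainBasis B) (h : ∀ b ∈ B, WayBelow b b) :
    (frameOfBasis hB).IsAlgebraic := by
  intro i X hX b hb
  refine ⟨hX, ?_⟩
  rcases hb with rfl | hb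
  · exact h _ b.2
  · rcases hX with rfl | hX
    · obtain rfl := Finset.mem_singleton.1 hb
      exact h _ b.2
    · exact hX b hb

/-- A nonempty set with supremum the least element contains only that element; so the least element
lies in every basis and approximates itself, hence everything. -/
theorem frameOfBasis_hasTruthElement (hB : IsDomainBasis B) (h : IsPointedOrder D) :
    (frameOfBasis hB).HasTruthElement := by
  obtain ⟨t, ht⟩ := h
  obtain ⟨S, hSB, ⟨b, hb⟩, -, hl⟩ := hB t
  have hbt : b = t := le_antisymm (hl.1 hb) (ht b)
  subst hbt
  exact ⟨⟨b, (hSB hb).1⟩, fun (i : B) =>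
    ⟨Or.inr fun c hc => absurd hc (Finset.notMem_empty c), (hSB hb).2.trans_le (ht i.1)⟩⟩

end FrameOfBasis

namespace INF

/-! ## The domain of states of an information frame -/

/-- A state of an information frame: a set of tokens that is finitely consistent, closed under
entailment, and derivable from itself. -/
@[ext]
structure State (A : INF.{u}) : Type u where
  carrier : Set A.Token
  con : ∀ F : Finset A.Token, (F : Set A.Token) ⊆ carrier → ∃ i ∈ carrier, F ∈ A.Con i
  closed : ∀ {i} {X : Finset A.Token} {a}, i ∈ carrier → (X : Set A.Token) ⊆ carrier → A.Ent i X a → a ∈ carrier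
  derivable : ∀ {a}, a ∈ carrier → ∃ i ∈ carrier, ∃ X : Finset A.Token,
    (X : Set A.Token) ⊆ carrier ∧ A.Ent i X a

namespace State

variable {A B C : INF.{u}}

instance : PartialOrder (State A) :=
  PartialOrder.lift carrier fun _ _ h => State.ext h

theorem le_iff {x y : State A} : x ≤ y ↔ x.carrier ⊆ y.carrier := Iff.rfl

theorem nonempty (x : State A) : x.carrier.Nonempty :=
  let ⟨i, hi, _⟩ := x.con ∅ (by simp)
  ⟨i, hi⟩

/-- A finite subset of a state is consistent at some token of the state, and all its members are
accessible from that token. -/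
theorem exists_bound (x : State A) {F : Finset A.Token} (hF : (F : Set A.Token) ⊆ x.carrier) :
    ∃ k ∈ x.carrier, F ∈ A.Con k ∧ ∀ i ∈ F, A.R i k := by
  obtain ⟨k, hk, hFk⟩ := x.con F hF
  exact ⟨k, hk, hFk, fun i hi => A.con_mono (by simpa using hi) hFk⟩

/-- If `X ⊆ Y`, `Y` is consistent at `j`, and `i` is accessible from `j`, then
whatever is related to `X` at `i` is related to `Y` at `j`. -/
theorem _root_.INF.Hom.rel_of_subset (H : Hom A B) {i j : A.Token} {X Y : Finset A.Token}
    {b : B.Token} (hij : A.R i j) (hY : Y ∈ A.Con j) (hXY : X ⊆ Y) (h : H.rel i X b) :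
    H.rel j Y b :=
  H.mono (A.con_transfer hij (H.rel_con h)) hY hXY (H.transfer (H.rel_con h) hij h)

/-- Finitely many tokens related to parts of a state are related to a common part of it. -/
theorem exists_rel_finset (H : Hom A B) (x : State A) (F : Finset B.Token)
    (hF : ∀ b ∈ F, ∃ i ∈ x.carrier, ∃ X : Finset A.Token,
      (X : Set A.Token) ⊆ x.carrier ∧ H.rel i X b) :
    ∃ i ∈ x.carrier, ∃ X : Finset A.Token, (X : Set A.Token) ⊆ x.carrier ∧ X ∈ A.Con i ∧
      ∀ b ∈ F, H.rel i X b := by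
  classical
  have hF' : ∀ b : F, ∃ i ∈ x.carrier, ∃ X : Finset A.Token,
      (X : Set A.Token) ⊆ x.carrier ∧ H.rel i X b.1 := fun b => hF b.1 b.2
  choose i hi X hX hrel using hF'
  let G : Finset A.Token := F.attach.biUnion fun b => insert (i b) (X b)
  have hG : (G : Set A.Token) ⊆ x.carrier := by
    intro a ha
    obtain ⟨b, -, hb⟩ := Finset.mem_biUnion.1 (Finset.mem_coe.1 ha)
    rcases Finset.mem_insert.1 hb with rfl | hb
    · exact hi b
    · exact hX b hb
  have hsub : ∀ b, insert (i b) (X b) ⊆ G := fun b =>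
    Finset.subset_biUnion_of_mem (fun b => insert (i b) (X b)) (Finset.mem_attach F b)
  obtain ⟨k, hk, hGk, hR⟩ := x.exists_bound hG
  exact ⟨k, hk, G, hG, hGk, fun b hb => H.rel_of_subset
    (hR _ (hsub ⟨b, hb⟩ (Finset.mem_insert_self _ _))) hGk
    ((Finset.subset_insert _ _).trans (hsub ⟨b, hb⟩)) (hrel ⟨b, hb⟩)⟩

/-- The image of a state under an approximable mapping. -/
def map (H : Hom A B) (x : State A) : State B where
  carrier := {b | ∃ i ∈ x.carrier, ∃ X : Finset A.Token,
    (X : Set A.Token) ⊆ x.carrier ∧ H.rel i X b}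
  con F hF := by
    obtain ⟨i, hi, X, hX, hc, h⟩ := exists_rel_finset H x F fun b hb => hF hb
    obtain ⟨e, V, hV, h1, h2⟩ := H.interp_cod hc h
    exact ⟨e, ⟨i, hi, X, hX, h1 e (Set.mem_insert _ _)⟩, B.sound hV h2⟩
  closed := by
    classical
    intro k Y b hk hY hb
    obtain ⟨i, hi, X, hX, hc, h⟩ := exists_rel_finset H x (insert k Y) fun c hc => by
      rcases Finset.mem_insert.1 hc with rfl | hc
      · exact hk
      · exact hY hc
    exact ⟨i, hi, X, hX, H.rel_ent hc ⟨k, B.ent_con hb⟩ (fun c hc => h c (by simpa using hc)) hb⟩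
  derivable := by
    rintro b ⟨i, hi, X, hX, h⟩
    obtain ⟨e, V, hV, h1, h2⟩ := H.interp_cod (F := {b}) (H.rel_con h) (by simpa using h)
    exact ⟨e, ⟨i, hi, X, hX, h1 e (Set.mem_insert _ _)⟩, V,
      fun c hc => ⟨i, hi, X, hX, h1 c (Set.mem_insert_of_mem _ hc)⟩, h2 b (by simp)⟩

/-- Closure under entailment is one inclusion, derivability the other. -/
theorem map_id (x : State A) : map (Hom.id A) x = x := by
  ext a
  exact ⟨fun ⟨_, hi, _, hX, h⟩ => x.closed hi hX h, fun h => x.derivable h⟩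

theorem map_comp (G : Hom A B) (H : Hom B C) (x : State A) :
    map (G.comp H) x = map H (map G x) := by
  classical
  ext c
  constructor
  · rintro ⟨i, hi, X, hX, e, V, hV, h1, h2⟩
    exact ⟨e, ⟨i, hi, X, hX, h1 e (Set.mem_insert _ _)⟩, V,
      fun b hb => ⟨i, hi, X, hX, h1 b (Set.mem_insert_of_mem _ hb)⟩, h2⟩
  · rintro ⟨e, he, V, hV, h2⟩
    -- The finitely many tokens `e` and `V`, derived from different parts of `x`, are derived from
    -- one common part.
    obtain ⟨i, hi, X, hX, -, h⟩ := exists_rel_finset G x (insert e V) fun b hb => by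
      rcases Finset.mem_insert.1 hb with rfl | hb
      · exact he
      · exact hV hb
    exact ⟨i, hi, X, hX, e, V, H.rel_con h2, fun b hb => h b (by simpa using hb), h2⟩

/-- The state generated by a consistent set. -/
def principal (i : A.Token) (X : Finset A.Token) (hX : X ∈ A.Con i) : State A where
  -- In general neither `i` nor `X` need lie in this state; interpolation supplies the node and the
  -- premises found inside it.
  carrier := {a | A.Ent i X a}
  con F hF := by
    obtain ⟨e, Z, hZ, h1, h2⟩ := A.interpolation hX hF
    exact ⟨e, h1 e (Set.mem_insert _ _), A.sound hZ h2⟩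
  closed := by
    intro j Y a hj hY h
    refine A.strong_cut (j := j) (Y := Y) ?_ h
    rintro b (rfl | hb)
    · exact hj
    · exact hY hb
  derivable := by
    intro a ha
    obtain ⟨e, Z, hZ, h1, h2⟩ := A.interpolation (Y := {a}) hX (by simpa using ha)
    exact ⟨e, h1 e (Set.mem_insert _ _), Z, fun b hb => h1 b (Set.mem_insert_of_mem _ hb),
      h2 a (by simp)⟩

theorem principal_le_principal {i j : A.Token} {X Y : Finset A.Token} {hX : X ∈ A.Con i}
    {hY : Y ∈ A.Con j} (h : ∀ a, A.Ent i X a → A.Ent j Y a) :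
    principal i X hX ≤ principal j Y hY := h

theorem principal_le {i : A.Token} {X : Finset A.Token} {hX : X ∈ A.Con i} {x : State A}
    (hi : i ∈ x.carrier) (h : (X : Set A.Token) ⊆ x.carrier) : principal i X hX ≤ x :=
  fun _ ha => x.closed hi h ha

/-- The union of a nonempty directed set of states. -/
def sUnion (S : Set (State A)) (hS : S.Nonempty) (hd : DirectedOn (· ≤ ·) S) : State A where
  carrier := ⋃ x ∈ S, x.carrier
  con F hF := by
    obtain ⟨x, hx, hFx⟩ := DirectedOn.exists_mem_subset_of_finset_subset_biUnion hS hd hF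
    obtain ⟨i, hi, h⟩ := x.con F hFx
    exact ⟨i, Set.mem_biUnion hx hi, h⟩
  closed := by
    classical
    intro i X a hi hX h
    obtain ⟨x, hx, hs⟩ := DirectedOn.exists_mem_subset_of_finset_subset_biUnion
      (f := State.carrier) (s := insert i X) hS hd (by
        rw [Finset.coe_insert]
        exact Set.insert_subset hi hX)
    rw [Finset.coe_insert, Set.insert_subset_iff] at hs
    exact Set.mem_biUnion hx (x.closed hs.1 hs.2 h)
  derivable := by
    intro a ha
    obtain ⟨x, hx, hax⟩ := Set.mem_iUnion₂.1 ha
    obtain ⟨i, hi, X, hX, h⟩ := x.derivable hax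
    exact ⟨i, Set.mem_biUnion hx hi, X, fun b hb => Set.mem_biUnion hx (hX hb), h⟩

theorem isLUB_of_carrier_eq {S : Set (State A)} {x : State A}
    (h : x.carrier = ⋃ y ∈ S, y.carrier) : IsLUB S x := by
  refine ⟨fun y hy => ?_, fun u hu => ?_⟩
  · rw [le_iff, h]
    exact Set.subset_biUnion_of_mem (u := State.carrier) hy
  · rw [le_iff, h]
    exact Set.iUnion₂_subset fun y hy => hu hy

theorem isDcpo (A : INF.{u}) : IsDcpo (State A) :=
  fun S hS hd => ⟨sUnion S hS hd, isLUB_of_carrier_eq rfl⟩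

theorem carrier_eq_of_isLUB {S : Set (State A)} (hS : S.Nonempty) (hd : DirectedOn (· ≤ ·) S)
    {x : State A} (hx : IsLUB S x) : x.carrier = ⋃ y ∈ S, y.carrier :=
  congrArg carrier (hx.unique (isLUB_of_carrier_eq (x := sUnion S hS hd) rfl))

/-- Only the finite set `insert i X` matters: once contained in a directed union of states, it is
contained in one of them. -/
theorem principal_wayBelow {i : A.Token} {X : Finset A.Token} {hX : X ∈ A.Con i} {x : State A}
    (hi : i ∈ x.carrier) (h : (X : Set A.Token) ⊆ x.carrier) :
    WayBelow (principal i X hX) x := by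
  classical
  intro S hS hd s hs hxs
  rw [le_iff, carrier_eq_of_isLUB hS hd hs] at hxs
  obtain ⟨y, hy, hsub⟩ := DirectedOn.exists_mem_subset_of_finset_subset_biUnion
    (f := State.carrier) (s := insert i X) hS hd (by
      rw [Finset.coe_insert]
      exact (Set.insert_subset hi h).trans hxs)
  rw [Finset.coe_insert, Set.insert_subset_iff] at hsub
  exact ⟨y, hy, principal_le hsub.1 hsub.2⟩

/-- The principal states of the consistent sets contained in a state. -/
def principals (x : State A) : Set (State A) :=
  {y | ∃ (i : A.Token) (X : Finset A.Token) (hX : X ∈ A.Con i),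
    i ∈ x.carrier ∧ (X : Set A.Token) ⊆ x.carrier ∧ y = principal i X hX}

theorem principals_nonempty (x : State A) : (principals x).Nonempty :=
  let ⟨i, hi⟩ := x.nonempty
  ⟨_, i, ∅, A.empty_con i, hi, by simp, rfl⟩

/-- Two generating sets together with their nodes form a finite part of `x`. This part is consistent
at some `k ∈ x` from which both nodes are accessible, so both entailments transfer to `k`. -/
theorem principals_directedOn (x : State A) : DirectedOn (· ≤ ·) (principals x) := by
  classical
  rintro _ ⟨i, X, hX, hi, hXx, rfl⟩ _ ⟨j, Y, hY, hj, hYx, rfl⟩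
  obtain ⟨k, hk, hG, hR⟩ := x.exists_bound (F := insert i X ∪ insert j Y) (by
    rw [Finset.coe_union, Finset.coe_insert, Finset.coe_insert]
    exact Set.union_subset (Set.insert_subset hi hXx) (Set.insert_subset hj hYx))
  have hle : ∀ {l : A.Token} {Z : Finset A.Token} (hZ : Z ∈ A.Con l),
      insert l Z ⊆ insert i X ∪ insert j Y → principal l Z hZ ≤ principal k _ hG :=
    fun hZ hsub a ha => (Hom.id A).rel_of_subset (hR _ (hsub (Finset.mem_insert_self _ _))) hG
      ((Finset.subset_insert _ _).trans hsub) ha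
  refine ⟨_, ⟨k, _, hG, hk, ?_, rfl⟩, hle hX Finset.subset_union_left,
    hle hY Finset.subset_union_right⟩
  rw [Finset.coe_union, Finset.coe_insert, Finset.coe_insert]
  exact Set.union_subset (Set.insert_subset hi hXx) (Set.insert_subset hj hYx)

theorem principals_isLUB (x : State A) : IsLUB (principals x) x := by
  refine ⟨?_, fun u hu a ha => ?_⟩
  · rintro _ ⟨i, X, hX, hi, hXx, rfl⟩
    exact principal_le hi hXx
  · obtain ⟨i, hi, X, hX, h⟩ := x.derivable ha
    exact hu ⟨i, X, A.ent_con h, hi, hX, rfl⟩ h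

theorem isDomainOrder (A : INF.{u}) : IsDomainOrder (State A) := by
  refine ⟨isDcpo A, Set.univ, fun x => ⟨principals x, ?_, principals_nonempty x,
    principals_directedOn x, principals_isLUB x⟩⟩
  rintro _ ⟨i, X, hX, hi, hXx, rfl⟩
  exact ⟨Set.mem_univ _, principal_wayBelow hi hXx⟩

/-- Condition (AL) places `i` and `X` inside the state they generate, so `principal_wayBelow`
applies to that state itself and principal states are compact. -/
theorem isAlgebraicOrder (hA : A.IsAlgebraic) : IsAlgebraicOrder (State A) := by
  refine ⟨isDcpo A, fun x => ⟨principals x, ?_, principals_nonempty x,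
    principals_directedOn x, principals_isLUB x⟩⟩
  rintro _ ⟨i, X, hX, hi, hXx, rfl⟩
  refine ⟨isCompactElement_iff_wayBelow.2 (principal_wayBelow ?_ ?_), principal_wayBelow hi hXx⟩
  · exact hA i X hX i (Set.mem_insert _ _)
  · exact fun a ha => hA i X hX a (Set.mem_insert_of_mem _ ha)

theorem isPointedOrder (hA : A.HasTruthElement) : IsPointedOrder (State A) := by
  obtain ⟨t, ht⟩ := hA
  refine ⟨principal t ∅ (A.empty_con t), fun x => ?_⟩
  -- Since `∅` entails `t` at every node, any token `i` of `x` forces `t` into `x`.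
  obtain ⟨i, hi⟩ := x.nonempty
  exact principal_le (x.closed hi (by simp) (ht i)) (by simp)

/-! ## Approximable mappings and Scott continuous functions -/

theorem map_mono (H : Hom A B) : Monotone (map H) := by
  rintro x y hxy b ⟨i, hi, X, hX, h⟩
  exact ⟨i, hxy hi, X, hX.trans hxy, h⟩

theorem map_scottContinuous (H : Hom A B) : ScottContinuous (map H) := by
  classical
  intro S hS hd x hx
  refine ⟨(map_mono H).mem_upperBounds_image hx.1, fun u hu b hb => ?_⟩
  obtain ⟨i, hi, X, hX, h⟩ := hb
  rw [carrier_eq_of_isLUB hS hd hx] at hi hX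
  obtain ⟨y, hy, hsub⟩ := DirectedOn.exists_mem_subset_of_finset_subset_biUnion
    (f := State.carrier) (s := insert i X) hS hd (by
      rw [Finset.coe_insert]
      exact Set.insert_subset hi hX)
  rw [Finset.coe_insert, Set.insert_subset_iff] at hsub
  exact hu ⟨y, hy, rfl⟩ ⟨i, hsub.1, X, hsub.2, h⟩

/-- An approximable mapping can be read off from its action on principal states. As `X` may lie
outside the state it generates, one direction needs interpolation in the domain. -/
theorem mem_map_principal (H : Hom A B) {i : A.Token} {X : Finset A.Token} {b : B.Token}
    (hX : X ∈ A.Con i) : b ∈ (map H (principal i X hX)).carrier ↔ H.rel i X b := by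
  constructor
  · rintro ⟨j, hj, Y, hY, h⟩
    refine H.strong_ent_rel (j := j) (Y := Y) ?_ h
    rintro a (rfl | ha)
    · exact hj
    · exact hY ha
  · intro h
    obtain ⟨c, U, hU, h1, h2⟩ := H.interp_dom (F := {b}) hX (by simpa using h)
    exact ⟨c, h1 c (Set.mem_insert _ _), U, fun a ha => h1 a (Set.mem_insert_of_mem _ ha),
      h2 b (by simp)⟩

theorem map_injective : Function.Injective (map : Hom A B → State A → State B) := by
  intro H K h
  ext i X b
  constructor
  · intro hr
    rw [← mem_map_principal K (H.rel_con hr), ← h]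
    exact (mem_map_principal H _).2 hr
  · intro hr
    rw [← mem_map_principal H (K.rel_con hr), h]
    exact (mem_map_principal K _).2 hr

/-- The value of a Scott continuous function is the union of its values at principal states. -/
theorem exists_principal_of_finset {f : State A → State B} (hf : ScottContinuous f) (x : State A)
    {F : Finset B.Token} (hF : (F : Set B.Token) ⊆ (f x).carrier) :
    ∃ (c : A.Token) (U : Finset A.Token) (hU : U ∈ A.Con c), c ∈ x.carrier ∧
      (U : Set A.Token) ⊆ x.carrier ∧ (F : Set B.Token) ⊆ (f (principal c U hU)).carrier := by
  have hd := principals_directedOn x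
  have hd' : DirectedOn (· ≤ ·) (f '' principals x) := by
    rintro _ ⟨y, hy, rfl⟩ _ ⟨z, hz, rfl⟩
    obtain ⟨w, hw, hyw, hzw⟩ := hd y hy z hz
    exact ⟨f w, ⟨w, hw, rfl⟩, hf.monotone hyw, hf.monotone hzw⟩
  have hne := (principals_nonempty x).image f
  rw [carrier_eq_of_isLUB hne hd' (hf (principals_nonempty x) hd (principals_isLUB x))] at hF
  obtain ⟨_, ⟨_, ⟨c, U, hU, hc, hUx, rfl⟩, rfl⟩, hsub⟩ :=
    DirectedOn.exists_mem_subset_of_finset_subset_biUnion (f := State.carrier) hne hd' hF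
  exact ⟨c, U, hU, hc, hUx, hsub⟩

/-- The approximable mapping of a Scott continuous function between domains of states. -/
def ofScott (f : State A → State B) (hf : ScottContinuous f) : Hom A B where
  rel i X b := ∃ hX : X ∈ A.Con i, b ∈ (f (principal i X hX)).carrier
  rel_con h := h.1
  rel_ent hX _ h hb :=
    ⟨hX, (f _).closed (h _ (Set.mem_insert _ _)).2
      (fun c hc => (h c (Set.mem_insert_of_mem _ hc)).2) hb⟩
  mono hX hX' hs h :=
    ⟨hX', hf.monotone (principal_le_principal fun _ => A.weaken hX hX' hs) h.2⟩
  ent_rel hX hX' hs h :=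
    ⟨hX, hf.monotone (principal_le_principal fun _ => A.cut hX hs) h.2⟩
  transfer hX hR h :=
    ⟨A.con_transfer hR hX,
      hf.monotone (principal_le_principal fun _ => A.ent_transfer hR hX) h.2⟩
  interpolation := by
    intro i X F hX h
    -- Continuity of `f` yields the interpolant `(c, U)` in the source; derivability of the state `f
    -- (principal c U hU)` yields `(e, V)` in the target.
    obtain ⟨c, U, hU, hc, hUx, hF⟩ := exists_principal_of_finset hf (principal i X hX)
      (F := F) fun b hb => (h b hb).2
    obtain ⟨e, he, V, hV, hVe, hVF⟩ := exists_rel_finset (Hom.id B) (f (principal c U hU)) F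
      fun b hb => (f _).derivable (hF hb)
    refine ⟨c, e, U, V, hU, hVe, ?_, ?_, hVF⟩
    · rintro a (rfl | ha)
      · exact hc
      · exact hUx ha
    · rintro b (rfl | hb)
      · exact ⟨hU, he⟩
      · exact ⟨hU, hV hb⟩

theorem map_ofScott (f : State A → State B) (hf : ScottContinuous f) :
    map (ofScott f hf) = f := by
  funext x
  ext b
  constructor
  · rintro ⟨i, hi, X, hX, hXi, h⟩
    exact hf.monotone (principal_le hi hX) h
  · intro h
    obtain ⟨c, U, hU, hc, hUx, hF⟩ := exists_principal_of_finset hf x (F := {b}) (by simpa using h)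
    exact ⟨c, hc, U, hUx, hU, hF (by simp)⟩

/-! ## States of the frame of a domain -/

section FrameOfBasis

variable {D : Type u} [PartialOrder D] {B : Set D}

/-- The basis elements approximating `d` form a state of the frame of the basis. -/
def ofElement (hB : IsDomainBasis B) (d : D) : State (frameOfBasis hB) where
  carrier := {b : B | WayBelow b.1 d}
  con F hF := by
    obtain ⟨e, he, hed, hFe⟩ := hB.interpolation (fun b : B => b.1) F fun b hb => hF hb
    exact ⟨⟨e, he⟩, hed, Or.inr hFe⟩
  closed hi _ h := h.2.trans hi
  derivable := by
    intro a ha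
    obtain ⟨e, he, hed, hFe⟩ := hB.interpolation (fun b : B => b.1) {a} fun b hb => by
      obtain rfl := Finset.mem_singleton.1 hb
      exact ha
    exact ⟨⟨e, he⟩, hed, ∅, by simp, Or.inr fun c hc => absurd hc (Finset.notMem_empty c),
      hFe a (Finset.mem_singleton_self a)⟩

theorem ofElement_le_iff (hB : IsDomainBasis B) {d d' : D} :
    ofElement hB d ≤ ofElement hB d' ↔ d ≤ d' := by
  constructor
  · intro h
    obtain ⟨S, hSB, -, -, hl⟩ := hB d
    refine hl.2 fun b hb => WayBelow.le ?_
    exact h (show (⟨b, (hSB hb).1⟩ : B) ∈ (ofElement hB d).carrier from (hSB hb).2)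
  · exact fun h b hb => WayBelow.trans_le hb h

/-- A state, viewed as a subset of `D`, is directed; the element it comes from is its supremum. -/
theorem ofElement_surjective (hB : IsDomainBasis B) (hD : IsDcpo D) :
    Function.Surjective (ofElement hB) := by
  intro x
  -- Derivability makes the state rounded: each member approximates another member.
  have hround : ∀ a ∈ x.carrier, ∃ i ∈ x.carrier, WayBelow a.1 i.1 := fun a ha =>
    let ⟨i, hi, _, _, h⟩ := x.derivable ha
    ⟨i, hi, h.2⟩
  let S : Set D := Subtype.val '' (x.carrier : Set B)
  have hS : S.Nonempty := x.nonempty.image _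
  have hd : DirectedOn (· ≤ ·) S := by
    classical
    rintro _ ⟨(a : B), ha, rfl⟩ _ ⟨(b : B), hb, rfl⟩
    obtain ⟨F, hF⟩ : ∃ F : Finset B, ∀ c, c ∈ F ↔ c = a ∨ c = b := ⟨{a, b}, by simp⟩
    obtain ⟨i, hi, hFi⟩ := x.con F fun c hc => by
      rcases (hF c).1 hc with rfl | rfl
      · exact ha
      · exact hb
    have hle : ∀ c ∈ F, c.1 ≤ i.1 := fun c hc => by
      -- The exceptional consistent set `{i}` still lies below `i`, which is all that directedness
      -- requires.
      rcases hFi with rfl | hFi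
      · exact (congrArg Subtype.val (Finset.mem_singleton.1 hc)).le
      · exact (hFi c hc).le
    exact ⟨_, ⟨i, hi, rfl⟩, hle a ((hF a).2 (Or.inl rfl)), hle b ((hF b).2 (Or.inr rfl))⟩
  obtain ⟨s, hs⟩ := hD S hS hd
  refine ⟨s, State.ext (Set.ext fun (b : B) => ⟨fun hb => ?_, fun hb => ?_⟩)⟩
  -- From `b ≪ s` comes `b ≤ v` with `v` in the state; roundness gives `v ≪ i`, so `b` is entailed
  -- at `i` by the empty set.
  · obtain ⟨_, ⟨v, hv, rfl⟩, hbv⟩ := hb S hS hd s hs le_rfl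
    obtain ⟨i, hi, hvi⟩ := hround v hv
    exact x.closed (X := ∅) hi (by simp) ⟨Or.inr fun c hc => absurd hc (Finset.notMem_empty c),
      WayBelow.le_trans hbv hvi⟩
  · obtain ⟨i, hi, hbi⟩ := hround b hb
    exact hbi.trans_le (hs.1 ⟨i, hi, rfl⟩)

/-- A dcpo with a basis is isomorphic to the domain of states of the frame of the basis. -/
noncomputable def orderIsoState (hB : IsDomainBasis B) (hD : IsDcpo D) : D ≃o State (frameOfBasis hB) :=
  RelIso.ofSurjective (OrderEmbedding.ofMapLEIff (ofElement hB) fun _ _ => ofElement_le_iff hB)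
    (ofElement_surjective hB hD)

end FrameOfBasis

end State

/-! ## The functor of states -/

/-- The functor sending an information frame to its domain of states. -/
def stateFunctor : INF.{u} ⥤ DOM.{u} where
  obj A := ⟨State A, State.isDomainOrder A⟩
  map H := ⟨State.map H, State.map_scottContinuous H⟩
  map_id _ := DOM.Hom.ext (funext State.map_id)
  map_comp G H := DOM.Hom.ext (funext (State.map_comp G H))

instance : stateFunctor.{u}.Faithful where
  map_injective h := State.map_injective (congrArg DOM.Hom.toFun h)

instance : stateFunctor.{u}.Full where
  map_surjective f := ⟨State.ofScott f.toFun f.scott, DOM.Hom.ext (State.map_ofScott _ f.scott)⟩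

end INF

/-! ### Essential images and the equivalences -/

theorem OrderIso.scottContinuous {α β : Type*} [PartialOrder α] [PartialOrder β] (e : α ≃o β) :
    ScottContinuous e :=
  fun _ _ _ _ h => e.isLUB_image'.2 h

/-- Order isomorphic domains are isomorphic. -/
def DOM.isoMk {D E : DOM.{u}} (e : D.carrier ≃o E.carrier) : D ≅ E where
  hom := ⟨e, e.scottContinuous⟩
  inv := ⟨e.symm, e.symm.scottContinuous⟩
  hom_inv_id := DOM.Hom.ext (funext e.symm_apply_apply)
  inv_hom_id := DOM.Hom.ext (funext e.apply_symm_apply)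

theorem stateFunctor_obj_iso (D : DOM.{u}) {B : Set D.carrier} (hB : IsDomainBasis B) :
    Nonempty (INF.stateFunctor.obj (frameOfBasis hB) ≅ D) :=
  ⟨(DOM.isoMk (INF.State.orderIsoState hB D.isDomain.1)).symm⟩

namespace TINF

/-- The underlying information frame. -/
def forget : TINF.{u} ⥤ INF.{u} where
  obj A := A.frame
  map H := H.toHom

instance : forget.{u}.Faithful where
  map_injective h := Hom.ext h

/-- Every approximable mapping respects truth elements. -/
theorem _root_.INF.Hom.respectsTruth {A B : INF.{u}} (H : INF.Hom A B) : H.RespectsTruth := by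
  intro t t' _ ht'
  -- Interpolating the empty set of conclusions still produces a node `e` of `B` related to `∅`;
  -- since `∅` entails `t'` at `e`, so is `t'`.
  obtain ⟨e, V, -, h1, -⟩ := H.interp_cod (F := ∅) (A.empty_con t) (by simp)
  have he := h1 e (Set.mem_insert _ _)
  exact H.rel_ent (k := e) (Y := ∅) (A.empty_con t) ⟨e, B.empty_con e⟩ (by simpa using he) (ht' e)

instance : forget.{u}.Full where
  map_surjective f := ⟨⟨f, INF.Hom.respectsTruth f⟩, rfl⟩

end TINF

/-- A fully faithful functor is an equivalence onto the full subcategory on any property that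
describes its essential image. -/
theorem CategoryTheory.Functor.nonempty_fullSubcategory_equivalence {C E : Type*} [Category C]
    [Category E] (F : C ⥤ E) [F.Full] [F.Faithful] (P : ObjectProperty E)
    (hP : ∀ X, P (F.obj X)) (hF : ∀ Y, P Y → ∃ X, Nonempty (F.obj X ≅ Y)) :
    Nonempty (P.FullSubcategory ≌ C) := by
  have : (P.lift F hP).EssSurj := ⟨fun Y => by
    obtain ⟨X, ⟨e⟩⟩ := hF Y.obj Y.property
    exact ⟨X, ⟨P.isoMk e⟩⟩⟩
  have : (P.lift F hP).IsEquivalence := {}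
  exact ⟨(P.lift F hP).asEquivalence.symm⟩

theorem IsAlgebraicOrder.frame_isAlgebraic {D : Type u} [PartialOrder D]
    (h : IsAlgebraicOrder D) : (frameOfBasis h.2).IsAlgebraic :=
  frameOfBasis_isAlgebraic h.2 fun _ hb => isCompactElement_iff_wayBelow.1 hb

theorem mainTheorem5 :
    Nonempty (DOM.{u} ≌ SINF.{u}) ∧
    (Nonempty (PDOM.{u} ≌ TINF.{u}) ∧ Nonempty (PDOM.{u} ≌ STINF.{u})) ∧
    (Nonempty (ADOM.{u} ≌ AINF.{u}) ∧ Nonempty (ADOM.{u} ≌ ASINF.{u})) ∧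
    (Nonempty (APDOM.{u} ≌ ATINF.{u}) ∧ Nonempty (APDOM.{u} ≌ ASTINF.{u})) := by
  refine ⟨?_, ⟨?_, ?_⟩, ⟨?_, ?_⟩, ⟨?_, ?_⟩⟩
  -- Every domain has some basis, and the frame of any basis is strong, so strong frames already
  -- reach all of `DOM`.
  · have : (ObjectProperty.ι _ ⋙ INF.stateFunctor : SINF.{u} ⥤ DOM.{u}).EssSurj := ⟨fun D => by
      obtain ⟨B, hB⟩ := D.isDomain.2
      exact ⟨⟨_, frameOfBasis_isStrong hB⟩, stateFunctor_obj_iso D hB⟩⟩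
    have : (ObjectProperty.ι _ ⋙ INF.stateFunctor : SINF.{u} ⥤ DOM.{u}).IsEquivalence := {}
    exact ⟨(ObjectProperty.ι _ ⋙ INF.stateFunctor : SINF.{u} ⥤ DOM.{u}).asEquivalence.symm⟩
  · refine (TINF.forget ⋙ INF.stateFunctor).nonempty_fullSubcategory_equivalence _
      (fun A => INF.State.isPointedOrder A.hasTruth) fun D hD => ?_
    obtain ⟨B, hB⟩ := D.isDomain.2
    exact ⟨⟨_, frameOfBasis_hasTruthElement hB hD⟩, stateFunctor_obj_iso D hB⟩
  · refine (ObjectProperty.ι _ ⋙ TINF.forget ⋙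
      INF.stateFunctor).nonempty_fullSubcategory_equivalence _
      (fun A => INF.State.isPointedOrder A.obj.hasTruth) fun D hD => ?_
    obtain ⟨B, hB⟩ := D.isDomain.2
    exact ⟨⟨⟨_, frameOfBasis_hasTruthElement hB hD⟩, frameOfBasis_isStrong hB⟩,
      stateFunctor_obj_iso D hB⟩
  -- Here the basis must be the compact elements, so that the frame is algebraic.
  · exact (ObjectProperty.ι _ ⋙ INF.stateFunctor).nonempty_fullSubcategory_equivalence _
      (fun A => INF.State.isAlgebraicOrder A.property) fun D hD =>
      ⟨⟨_, hD.frame_isAlgebraic⟩, stateFunctor_obj_iso D hD.2⟩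
  · exact (ObjectProperty.ι _ ⋙ INF.stateFunctor).nonempty_fullSubcategory_equivalence _
      (fun A => INF.State.isAlgebraicOrder A.property.1) fun D hD =>
      ⟨⟨_, hD.frame_isAlgebraic, frameOfBasis_isStrong hD.2⟩, stateFunctor_obj_iso D hD.2⟩
  · exact (ObjectProperty.ι _ ⋙ TINF.forget ⋙
      INF.stateFunctor).nonempty_fullSubcategory_equivalence _
      (fun A => ⟨INF.State.isAlgebraicOrder A.property, INF.State.isPointedOrder A.obj.hasTruth⟩)
      fun D hD => ⟨⟨⟨_, frameOfBasis_hasTruthElement hD.1.2 hD.2⟩, hD.1.frame_isAlgebraic⟩,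
        stateFunctor_obj_iso D hD.1.2⟩
  · exact (ObjectProperty.ι _ ⋙ TINF.forget ⋙
      INF.stateFunctor).nonempty_fullSubcategory_equivalence _
      (fun A => ⟨INF.State.isAlgebraicOrder A.property.1,
        INF.State.isPointedOrder A.obj.hasTruth⟩)
      fun D hD => ⟨⟨⟨_, frameOfBasis_hasTruthElement hD.1.2 hD.2⟩, hD.1.frame_isAlgebraic,
        frameOfBasis_isStrong hD.1.2⟩, stateFunctor_obj_iso D hD.1.2⟩
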